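/- Let $n_1,n_2\ge 0$, $n=n_1+n_2$, and write $x=\mathrm{col}[x_1,x_2]\in\mathbb R^n$ with $x_i\in\mathbb R^{n_i}$; $|\cdot|$ is the Euclidean norm and $\mathcal B(r)=\{x:|x|\le r\}$. Let $F=\mathrm{col}[F_1,F_2]:\mathbb R\times\mathbb R^n\to\mathbb R^n$ satisfy the Carathéodory conditions: $F(\cdot,x)$ is measurable for every $x$, $F(t,\cdot)$ is continuous for almost every $t$, and for every $r$ there is a locally integrable $m_r$ with $|F(t,x)|\le m_r(t)$ for almost all $t$ and all $x\in\mathcal B(r)$. Solutions of $\dot x=F(t,x)$ are understood in the sense $x(t)=x(t_0)+\int_{t_0}^tF(s,x(s))\,ds$. The origin is *uniformly globally stable* (UGS) if there is a continuous, strictly increasing, unbounded $\gamma:[0,\infty)\to[0,\infty)$ with $\gamma(0)=0$ such that every solution starting from any $(t_0,x_0)\in\mathbb R\times\mathbb R^n$ satisfies $|x(t)|\le\gamma(|x_0|)$ for all $t\ge t_0$. It is *uniformly globally attractive* if for all $r,\sigma>0$ there is $T>0$ such that for all $t_0$ and all $|x_0|\le r$ every solution starting from $(t_0,x_0)$ satisfies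 $|x(t)|\le\sigma$ for all $t\ge t_0+T$. It is UGAS if it is UGS and uniformly globally attractive. For locally Lipschitz $V:\mathbb R\times\mathbb R^n\to\mathbb R$ put $\dot V(t,x)=\frac{\partial V}{\partial t}(t,x)+\frac{\partial V}{\partial x}(t,x)F(t,x)$, which is defined for almost all $(t,x)$. A function $g$ of $(t,x)$ with $g(\cdot,x)$ locally integrable for each $x$ is *u$\delta$-PE with respect to $x_2$* if for each $x$ with $x_2\neq0$ there are $\delta,T,\mu>0$ such that $|z-x|\le\delta$ implies $\int_t^{t+T}|g(\tau,z)|\,d\tau\ge\mu$ for all $t\in\mathbb R$. It is *locally Lipschitz in $x$ uniformly in $t$* if each $x_0$ has a neighbourhood on which $g(t,\cdot)$ is Lipschitz with a constant that does not depend on $t\in\mathbb R$. **Theorem.** Assume that the origin is UGS, and that there are integers $j\ge1$, $m=m_1+m_2$ with $m_1\ge1$, $m_2\ge0$, such that for each $\Delta>0$ there exist a number $\mu>0$, locally Lipschitz functions $V_i:\mathbb R\times\mathbb R^n\to\mathbb R$ $(1\le i\le j)$, a continuous function $\phi=\mathrm{col}[\phi_1,\phi_2]:\mathbb R\times\mathbb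 R^n\to\mathbb R^{m_1}\times\mathbb R^{m_2}$, continuous functions $Y_i:\mathbb R^n\times\mathbb R^m\to\mathbb R$ $(1\le i\le j)$, and a continuous function $\rho:\mathbb R^{n_1}\times\mathbb R^{m_1}\to\mathbb R$ with $\rho(0,0)=0$, for which the following hold. 1. For almost all $(t,x)\in\mathbb R\times\mathcal B(\Delta)$ and all $i$: $\max\{|V_i(t,x)|,|\phi(t,x)|\}\le\mu$ and $\dot V_i(t,x)\le Y_i(x,\phi(t,x))$. 2. For each $k\in\{1,\dots,j\}$ and all $(z,\psi)\in\mathcal B(\Delta)\times\mathcal B(\mu)$: if $Y_i(z,\psi)=0$ for all $i<k$, then $Y_k(z,\psi)\le0$. 3. For all $(z,\psi)\in\mathcal B(\Delta)\times\mathcal B(\mu)$: if $Y_i(z,\psi)=0$ for all $i\in\{1,\dots,j\}$, then $z_1=0$ and $\psi_1=0$. 4. $\phi_1$ is independent of $x_1$, locally Lipschitz in $x_2$ uniformly in $t$, u$\delta$-PE with respect to $x_2$, and $\phi_1(t,0)=0$ for all $t$. 5. $|F_2(t,x)|\le\rho(x_1,\phi_1(t,x))$ for all $(t,x)\in\mathbb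 R\times\mathcal B(\Delta)$. Then the origin is UGAS. -/

import Mathlib

open MeasureTheory Set Filter Topology

/-- Vectors `x = col[x₁, x₂]` with `x₁ ∈ ℝᵃ`, `x₂ ∈ ℝᵇ`, with the Euclidean norm of `ℝᵃ⁺ᵇ`. -/
abbrev BlockVec (a b : ℕ) : Type := EuclideanSpace ℝ (Fin a ⊕ Fin b)

/-- The first block `x₁` of `x = col[x₁, x₂]`. -/
def BlockVec.fst {a b : ℕ} (x : BlockVec a b) : EuclideanSpace ℝ (Fin a) :=
  WithLp.toLp 2 (fun i => x (Sum.inl i))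

/-- The second block `x₂` of `x = col[x₁, x₂]`. -/
def BlockVec.snd {a b : ℕ} (x : BlockVec a b) : EuclideanSpace ℝ (Fin b) :=
  WithLp.toLp 2 (fun i => x (Sum.inr i))

section ODE

variable {E : Type*} [NormedAddCommGroup E] [NormedSpace ℝ E]

/-- The Carathéodory conditions on `F : ℝ × E → E`: measurable in time, continuous in the state,
and bounded on each ball by a locally integrable function of time. -/
structure IsCaratheodory (F : ℝ → E → E) : Prop where
  aestronglyMeasurable : ∀ x, AEStronglyMeasurable (fun t => F t x) volume
  continuous : ∀ᵐ t : ℝ, Continuous (F t)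
  bounded : ∀ r : ℝ, ∃ m : ℝ → ℝ, LocallyIntegrable m volume ∧
    ∀ᵐ t : ℝ, ∀ x : E, ‖x‖ ≤ r → ‖F t x‖ ≤ m t

/-- `x` solves `ẋ = F(t, x)`, `x(t₀) = x₀` on the interval `[t₀, t₁]`, in the integral
(equivalently: absolutely continuous) sense. -/
structure IsSolutionOn (F : ℝ → E → E) (t₀ t₁ : ℝ) (x₀ : E) (x : ℝ → E) : Prop where
  continuousOn : ContinuousOn x (Icc t₀ t₁)
  intervalIntegrable : IntervalIntegrable (fun s => F s (x s)) volume t₀ t₁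
  integral_eq : ∀ t ∈ Icc t₀ t₁, x t = x₀ + ∫ s in t₀..t, F s (x s)

/-- Class `𝒦_∞`: functions `[0, ∞) → [0, ∞)` that are continuous, strictly increasing, zero at
zero and unbounded (values at negative arguments are irrelevant). -/
structure IsClassKInf (γ : ℝ → ℝ) : Prop where
  continuousOn : ContinuousOn γ (Ici 0)
  strictMonoOn : StrictMonoOn γ (Ici 0)
  map_zero : γ 0 = 0
  tendsto : Tendsto γ atTop atTop

/-- Uniform global stability of the origin. The bound is imposed on every solution at every time
up to which it is defined; under the Carathéodory conditions a bounded solution can be continued,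
so every maximal solution is then defined for all `t ≥ t₀` and satisfies the bound there. -/
def UGS (F : ℝ → E → E) : Prop :=
  ∃ γ : ℝ → ℝ, IsClassKInf γ ∧
    ∀ (t₀ t₁ : ℝ) (x₀ : E) (x : ℝ → E), IsSolutionOn F t₀ t₁ x₀ x →
      ∀ t ∈ Icc t₀ t₁, ‖x t‖ ≤ γ ‖x₀‖

/-- Uniform global attractivity of the origin. -/
def UniformlyGloballyAttractive (F : ℝ → E → E) : Prop :=
  ∀ r > 0, ∀ σ > 0, ∃ T > 0,
    ∀ (t₀ t₁ : ℝ) (x₀ : E) (x : ℝ → E), IsSolutionOn F t₀ t₁ x₀ x → ‖x₀‖ ≤ r →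
      ∀ t ∈ Icc (t₀ + T) t₁, ‖x t‖ ≤ σ

/-- Uniform global asymptotic stability of the origin. -/
def UGAS (F : ℝ → E → E) : Prop :=
  UGS F ∧ UniformlyGloballyAttractive F

/-- The total derivative `V̇(t, x) = ∂V/∂t + (∂V/∂x) F(t, x)` along `ẋ = F(t, x)`. It is used for
locally Lipschitz `V` and almost every `(t, x)` only, where `V` is differentiable. -/
noncomputable def totalDeriv (F : ℝ → E → E) (V : ℝ × E → ℝ) (t : ℝ) (x : E) : ℝ :=
  fderiv ℝ V (t, x) (1, F t x)

/-- `φ(t, x)` is locally Lipschitz in `x` uniformly in `t`. -/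
def LocallyLipschitzUniformly {G : Type*} [NormedAddCommGroup G] (φ : ℝ → E → G) : Prop :=
  ∀ x₀ : E, ∃ L : ℝ, ∃ U ∈ 𝓝 x₀, ∀ x ∈ U, ∀ y ∈ U, ∀ t : ℝ, ‖φ t x - φ t y‖ ≤ L * ‖x - y‖

/-- `φ` is uniformly `δ`-persistently exciting with respect to the part `π x` of the state. -/
def UniformlyDeltaPE {P G : Type*} [Zero P] [NormedAddCommGroup G]
    (π : E → P) (φ : ℝ → E → G) : Prop :=
  (∀ x, LocallyIntegrable (fun t => φ t x) volume) ∧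
    ∀ x : E, π x ≠ 0 → ∃ δ > 0, ∃ T > 0, ∃ μ > 0, ∀ (t : ℝ) (z : E), ‖z - x‖ ≤ δ →
      μ ≤ ∫ τ in t..(t + T), ‖φ τ z‖

end ODE

/-! This is a Matrosov argument. Stability confines solutions from the ball of radius `r` to a ball
of radius `R = γ r`, and only one time with `‖x‖ ≤ δ`, `γ δ ≤ σ`, is needed: stability restarted
there gives `σ` forever. Such a time must occur before a deadline depending only on `r` and `σ`.

Let `Z = |x₁| + |φ₁| + |ρ|`, which vanishes wherever all `Y i` do. By compactness and the nested
sign condition, suitable weights `c i ≥ 0` give `∑ c i * Y i + Z < η`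
(`IsCompact.exists_nested_weights`). Integrated along a solution, with `V i` bounded, this makes the
time average of `Z` at most `η` up to a bounded total (`exists_integral_le_of_nested`). Hence some
window of fixed length `L` has small `∫ Z`. On it `x₁` is small at some time, `x₂` barely moves and
`∫ |φ₁|` is small; were `x₂` not small as well, excitation would contradict the last point
(`exists_norm_le_of_window`).

The delicate step is integrating `V̇`: its bound holds only for almost every `(t, x)`, and a
trajectory is a null set. By Fubini the bound holds along almost every translate of the trajectory,
and the shift then tends to zero (`sub_le_integral_of_totalDeriv_le`). -/

/-- A function whose increments are dominated by those of an absolutely continuous function is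
absolutely continuous. -/
theorem AbsolutelyContinuousOnInterval.of_dist_le {X Y : Type*} [PseudoMetricSpace X]
    [PseudoMetricSpace Y] {f : ℝ → X} {g : ℝ → Y} {a b : ℝ}
    (hg : AbsolutelyContinuousOnInterval g a b)
    (h : ∀ s ∈ uIcc a b, ∀ t ∈ uIcc a b, dist (f s) (f t) ≤ dist (g s) (g t)) :
    AbsolutelyContinuousOnInterval f a b := by
  rw [absolutelyContinuousOnInterval_iff] at hg ⊢
  intro ε hε
  obtain ⟨δ, hδ, H⟩ := hg ε hε
  refine ⟨δ, hδ, fun I hI hlen => lt_of_le_of_lt (Finset.sum_le_sum fun i hi => ?_) (H I hI hlen)⟩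
  exact h _ (hI.1 i hi).1 _ (hI.1 i hi).2

/-- A continuous function that is at most `c` almost everywhere on an open set is at most `c`
everywhere on it. -/
theorem Continuous.le_on_of_ae_le {X : Type*} [TopologicalSpace X] [MeasurableSpace X]
    {μ : Measure X} [μ.IsOpenPosMeasure] {f : X → ℝ} (hf : Continuous f) {U : Set X}
    (hU : IsOpen U) {c : ℝ} (h : ∀ᵐ p ∂μ, p ∈ U → f p ≤ c) : ∀ p ∈ U, f p ≤ c := by
  intro p hp
  by_contra! hlt
  have hopen : IsOpen (U ∩ {q | c < f q}) := hU.inter (isOpen_lt continuous_const hf)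
  have hnull : μ (U ∩ {q | c < f q}) = 0 := by
    rw [ae_iff] at h
    refine measure_mono_null ?_ h
    rintro q ⟨hq, hcq⟩
    simp only [mem_ofPred_eq] at hcq ⊢
    push Not
    exact ⟨hq, hcq⟩
  rw [hopen.measure_eq_zero_iff μ] at hnull
  exact (hnull ▸ (⟨hp, hlt⟩ : p ∈ U ∩ {q | c < f q}) : p ∈ (∅ : Set X))

theorem MeasureTheory.LocallyIntegrable.intervalIntegrable {G : Type*} [NormedAddCommGroup G]
    {f : ℝ → G} (hf : LocallyIntegrable f volume) (a b : ℝ) : IntervalIntegrable f volume a b :=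
  intervalIntegrable_iff.2 <|
    (hf.integrableOn_isCompact isCompact_uIcc).mono_set uIoc_subset_uIcc

/-! ### Carathéodory fields along continuous curves. -/

section Caratheodory

variable {E : Type*} [NormedAddCommGroup E] {F : ℝ → E → E}

/-- A Carathéodory function composed with a continuous curve is measurable in time. -/
theorem IsCaratheodory.aestronglyMeasurable_comp (hF : IsCaratheodory F) {y : ℝ → E}
    (hy : Continuous y) : AEStronglyMeasurable (fun t => F t (y t)) volume := by
  -- Time rounded down to the grid of mesh `1 / (n + 1)`: the state is frozen on countably many
  -- pieces, and continuity in the state gives the limit.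
  let q : ℕ → ℝ → ℝ := fun n t => (⌊(n + 1 : ℝ) * t⌋ : ℝ) / (n + 1 : ℝ)
  have hq : ∀ t, Tendsto (fun n => q n t) atTop (𝓝 t) := by
    intro t
    have h1 : ∀ n : ℕ, |q n t - t| ≤ 1 / ((n : ℝ) + 1) := by
      intro n
      have hn : (0 : ℝ) < n + 1 := by positivity
      have e : q n t - t = ((⌊(n + 1 : ℝ) * t⌋ : ℝ) - (n + 1) * t) / (n + 1) := by
        simp only [q]; field_simp
      rw [e, abs_div, abs_of_pos hn]
      gcongr
      rw [abs_le]
      constructor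
      · linarith [Int.lt_floor_add_one ((n + 1 : ℝ) * t)]
      · linarith [Int.floor_le ((n + 1 : ℝ) * t)]
    rw [tendsto_iff_dist_tendsto_zero]
    exact squeeze_zero (fun _ => dist_nonneg) h1 tendsto_one_div_add_atTop_nhds_zero_nat
  refine aestronglyMeasurable_of_tendsto_ae (f := fun (n : ℕ) t => F t (y (q n t))) atTop ?_ ?_
  · intro n
    have hcover : (⋃ k : ℤ, {t : ℝ | ⌊(n + 1 : ℝ) * t⌋ = k}) = univ := by
      ext t; simp
    have hmeas : ∀ k : ℤ, MeasurableSet {t : ℝ | ⌊(n + 1 : ℝ) * t⌋ = k} := fun k =>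
      (Int.measurable_floor.comp (measurable_const_mul _)) (measurableSet_singleton k)
    rw [← Measure.restrict_univ (μ := (volume : Measure ℝ)), ← hcover,
      aestronglyMeasurable_iUnion_iff]
    intro k
    refine ((hF.aestronglyMeasurable (y ((k : ℝ) / (n + 1)))).restrict).congr ?_
    filter_upwards [ae_restrict_mem (hmeas k)] with t ht
    simp only [q]
    rw [show ⌊(n + 1 : ℝ) * t⌋ = k from ht]
  · filter_upwards [hF.continuous] with t ht
    exact (ht.tendsto _).comp ((hy.tendsto _).comp (hq t))

/-- A Carathéodory function composed with a bounded continuous curve is integrable in time. -/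
theorem IsCaratheodory.intervalIntegrable_comp (hF : IsCaratheodory F) {y : ℝ → E}
    (hy : Continuous y) {r : ℝ} (hr : ∀ t, ‖y t‖ ≤ r) (a b : ℝ) :
    IntervalIntegrable (fun t => F t (y t)) volume a b := by
  obtain ⟨m, hm, hb⟩ := hF.bounded r
  refine (hm.intervalIntegrable a b).mono_fun
    (hF.aestronglyMeasurable_comp hy).restrict ?_
  filter_upwards [ae_restrict_of_ae hb] with t ht using (ht _ (hr t)).trans (le_abs_self _)

end Caratheodory

/-! ### Integrating almost everywhere derivative bounds along solutions. -/

section Chain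

variable {E : Type*} [NormedAddCommGroup E] [InnerProductSpace ℝ E] [FiniteDimensional ℝ E]
  {F : ℝ → E → E}

/-- Along a curve shifted by a generic vector `h`, the increment of a locally Lipschitz function is
bounded by its total derivative up to the mismatch of the vector field. -/
theorem sub_le_integral_shift {V : ℝ × E → ℝ} {S : Set (ℝ × E)} {K : NNReal}
    (hV : LipschitzOnWith K V S) {y : ℝ → E} {a b : ℝ} (hab : a ≤ b) {x₀ h : E}
    (hint : IntervalIntegrable (fun s => F s (y s)) volume a b)
    (heq : ∀ t ∈ Icc a b, y t = x₀ + ∫ s in a..t, F s (y s))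
    (hS : ∀ t ∈ Icc a b, S ∈ 𝓝 (t, y t + h)) {G : ℝ → ℝ}
    (hG : IntervalIntegrable G volume a b)
    (hh : ∀ᵐ t : ℝ, t ∈ Icc a b → DifferentiableAt ℝ V (t, y t + h) ∧
      totalDeriv F V t (y t + h) + K * ‖F t (y t) - F t (y t + h)‖ ≤ G t) :
    V (b, y b + h) - V (a, y a + h) ≤ ∫ t in a..b, G t := by
  set w : ℝ → ℝ := fun t => V (t, y t + h) with hw
  have hsub : ∀ {s t : ℝ}, s ∈ Icc a b → t ∈ Icc a b → uIcc s t ⊆ uIcc a b := by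
    intro s t hs ht
    rw [uIcc_of_le hab]
    exact (convex_Icc a b).ordConnected.uIcc_subset hs ht
  have hi1 : IntervalIntegrable (fun s => (K : ℝ) * (1 + ‖F s (y s)‖)) volume a b :=
    (intervalIntegrable_const.add hint.norm).const_mul _
  -- The graph of the shifted curve moves by at most elapsed time plus `∫ ‖F‖`, and `V` stretches
  -- this by at most `K`.
  have hAC : AbsolutelyContinuousOnInterval w a b := by
    refine (hi1.absolutelyContinuousOnInterval_intervalIntegral
      (c := a) left_mem_uIcc).of_dist_le ?_
    rw [uIcc_of_le hab]
    have key : ∀ s ∈ Icc a b, ∀ t ∈ Icc a b, s ≤ t → dist (w s) (w t) ≤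
        dist (∫ v in a..s, (K : ℝ) * (1 + ‖F v (y v)‖))
          (∫ v in a..t, (K : ℝ) * (1 + ‖F v (y v)‖)) := by
      intro s hs t ht hst
      have hsub' := hsub hs ht
      have i0 : IntervalIntegrable (fun v => F v (y v)) volume s t := hint.mono_set hsub'
      have has : IntervalIntegrable (fun v => F v (y v)) volume a s :=
        hint.mono_set (hsub (left_mem_Icc.2 hab) hs)
      have hat : IntervalIntegrable (fun v => F v (y v)) volume a t :=
        hint.mono_set (hsub (left_mem_Icc.2 hab) ht)
      have e1 : (∫ v in a..t, (K : ℝ) * (1 + ‖F v (y v)‖)) -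
          (∫ v in a..s, (K : ℝ) * (1 + ‖F v (y v)‖)) =
          ∫ v in s..t, (K : ℝ) * (1 + ‖F v (y v)‖) :=
        intervalIntegral.integral_interval_sub_left
          (hi1.mono_set (hsub (left_mem_Icc.2 hab) ht))
          (hi1.mono_set (hsub (left_mem_Icc.2 hab) hs))
      have e2 : (∫ v in s..t, (K : ℝ) * (1 + ‖F v (y v)‖)) =
          K * ((t - s) + ∫ v in s..t, ‖F v (y v)‖) := by
        rw [intervalIntegral.integral_const_mul,
          intervalIntegral.integral_add intervalIntegrable_const i0.norm]
        simp
      have e3 : y t - y s = ∫ v in s..t, F v (y v) := by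
        rw [heq t ht, heq s hs, add_sub_add_left_eq_sub]
        exact intervalIntegral.integral_interval_sub_left hat has
      have e4 : ‖y t - y s‖ ≤ ∫ v in s..t, ‖F v (y v)‖ := by
        rw [e3]; exact intervalIntegral.norm_integral_le_integral_norm hst
      have e5 := hV.dist_le_mul _ (mem_of_mem_nhds (hS t ht)) _ (mem_of_mem_nhds (hS s hs))
      rw [dist_comm, dist_comm (∫ v in a..s, (K : ℝ) * (1 + ‖F v (y v)‖)),
        Real.dist_eq (∫ v in a..t, (K : ℝ) * (1 + ‖F v (y v)‖)), e1, e2]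
      refine le_trans ?_ (le_abs_self _)
      refine e5.trans (mul_le_mul_of_nonneg_left ?_ K.2)
      rw [Prod.dist_eq, dist_add_right, Real.dist_eq, dist_eq_norm, abs_of_nonneg (by linarith)]
      refine max_le ?_ ?_
      · linarith [norm_nonneg (y t - y s)]
      · linarith
    intro s hs t ht
    rcases le_total s t with hst | hst
    · exact key s hs t ht hst
    · rw [dist_comm, dist_comm (∫ v in a..s, _)]
      exact key t ht s hs hst
  have hderiv : ∀ᵐ t : ℝ, t ∈ Ioo a b → deriv w t ≤ G t := by
    filter_upwards [hint.ae_hasDerivAt_integral, hh] with t h1 h2 ht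
    have htI : t ∈ Icc a b := Ioo_subset_Icc_self ht
    obtain ⟨hd, hle⟩ := h2 htI
    have hy' : HasDerivAt (fun s => y s + h) (F t (y t)) t := by
      have h3 := h1 (by rwa [uIcc_of_le hab]) a left_mem_uIcc
      refine HasDerivAt.add_const h ((h3.const_add x₀).congr_of_eventuallyEq ?_)
      filter_upwards [Icc_mem_nhds ht.1 ht.2] with s hs using heq s hs
    have hw' : HasDerivAt w (fderiv ℝ V (t, y t + h) (1, F t (y t))) t :=
      hd.hasFDerivAt.comp_hasDerivAt t ((hasDerivAt_id t).prodMk hy')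
    rw [hw'.deriv]
    refine le_trans ?_ hle
    -- The shifted curve still has velocity `F t (y t)`, while `totalDeriv` uses the field at the
    -- shifted point; the mismatch costs a factor `K`.
    have hsplit : ((1 : ℝ), F t (y t)) =
        (1, F t (y t + h)) + (0, F t (y t) - F t (y t + h)) := by simp
    rw [hsplit, map_add]
    refine add_le_add le_rfl ?_
    refine (Real.le_norm_self _).trans ((ContinuousLinearMap.le_opNorm _ _).trans ?_)
    have hn : ‖fderiv ℝ V (t, y t + h)‖ ≤ K :=
      norm_fderiv_le_of_lipschitzOn ℝ (hS t htI) hV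
    have hn2 : ‖((0 : ℝ), F t (y t) - F t (y t + h))‖ = ‖F t (y t) - F t (y t + h)‖ := by
      simp [Prod.norm_def]
    rw [hn2]
    gcongr
  calc V (b, y b + h) - V (a, y a + h) = ∫ t in a..b, deriv w t :=
        hAC.integral_deriv_eq_sub.symm
    _ ≤ ∫ t in a..b, G t := by
        refine intervalIntegral.integral_mono_ae_restrict hab hAC.intervalIntegrable_deriv hG ?_
        rw [← restrict_Ioo_eq_restrict_Icc]
        exact (ae_restrict_iff' measurableSet_Ioo).2 hderiv

variable [MeasurableSpace E] [BorelSpace E]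

/-- If `P` holds almost everywhere in `ℝ × E`, then for almost every shift `h` it holds almost
everywhere along the curve `t ↦ (t, y t + h)`. -/
theorem ae_ae_shift {P : ℝ × E → Prop} (hP : ∀ᵐ p, P p) {y : ℝ → E} (hy : Continuous y) :
    ∀ᵐ h : E, ∀ᵐ t : ℝ, P (t, y t + h) := by
  -- The shear `(t, h) ↦ (t, y t + h)` preserves Lebesgue measure, so null sets pull back to null
  -- sets and Fubini applies.
  have hsk : MeasurePreserving (fun q : ℝ × E => (q.1, y q.1 + q.2))
      ((volume : Measure ℝ).prod (volume : Measure E)) (volume.prod volume) :=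
    (MeasurePreserving.id volume).skew_product (g := fun t h => y t + h)
      ((hy.comp continuous_fst).add continuous_snd).measurable
      (Eventually.of_forall fun t => map_add_left_eq_self _ _)
  have h := (hsk.comp Measure.measurePreserving_swap).quasiMeasurePreserving.ae hP
  exact Measure.ae_ae_of_ae_prod h

/-- Along a bounded solution, a pointwise almost everywhere bound on the total derivative of a
locally Lipschitz function integrates to a bound on its increment. -/
theorem sub_le_integral_of_totalDeriv_le (hF : IsCaratheodory F) {V : ℝ × E → ℝ}
    (hV : LocallyLipschitz V) {g : ℝ × E → ℝ} (hg : Continuous g) {R Δ : ℝ} (hRΔ : R < Δ)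
    (hVg : ∀ᵐ p : ℝ × E, ‖p.2‖ ≤ Δ → totalDeriv F V p.1 p.2 ≤ g p)
    {y : ℝ → E} (hy : Continuous y) (hyR : ∀ t, ‖y t‖ ≤ R) {a b : ℝ} (hab : a ≤ b) {x₀ : E}
    (heq : ∀ t ∈ Icc a b, y t = x₀ + ∫ s in a..t, F s (y s)) :
    V (b, y b) - V (a, y a) ≤ ∫ t in a..b, g (t, y t) := by
  -- The unit margin in time makes `S` a neighbourhood of the shifted curve even at the endpoints;
  -- the margin `Δ - R` in space leaves room for `h`.
  set S : Set (ℝ × E) := Icc (a - 1) (b + 1) ×ˢ Metric.closedBall 0 Δ with hSdef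
  have hSc : IsCompact S := isCompact_Icc.prod (isCompact_closedBall 0 Δ)
  obtain ⟨K, hK⟩ := (hV.locallyLipschitzOn (s := S)).exists_lipschitzOnWith_of_compact hSc
  obtain ⟨M, hM⟩ := hSc.exists_bound_of_continuousOn hg.continuousOn
  obtain ⟨m, hm, hmb⟩ := hF.bounded Δ
  have hball : ∀ h : E, ‖h‖ < Δ - R → ∀ t, ‖y t + h‖ < Δ := fun h hh t => by
    linarith [norm_add_le (y t) h, hyR t]
  have hSn : ∀ h : E, ‖h‖ < Δ - R → ∀ t ∈ Icc a b, S ∈ 𝓝 (t, y t + h) := by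
    intro h hh t ht
    refine prod_mem_nhds (Icc_mem_nhds (by linarith [ht.1]) (by linarith [ht.2])) ?_
    refine mem_of_superset (Metric.isOpen_ball.mem_nhds ?_) Metric.ball_subset_closedBall
    simpa using hball h hh t
  set G : E → ℝ → ℝ := fun h t => g (t, y t + h) + K * ‖F t (y t) - F t (y t + h)‖ with hGdef
  -- Rademacher's theorem and the derivative bound, both transferred to almost every shift.
  have hgood := ae_ae_shift ((hK.ae_differentiableWithinAt_of_mem
    (μ := (volume : Measure ℝ).prod (volume : Measure E))).and hVg) hy
  have hgint : ∀ h : E, IntervalIntegrable (fun t => g (t, y t + h)) volume a b := fun h =>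
    (hg.comp (continuous_id.prodMk (hy.add continuous_const))).intervalIntegrable a b
  have hFy := hF.intervalIntegrable_comp hy hyR a b
  have hFyh : ∀ h : E, ‖h‖ < Δ - R →
      IntervalIntegrable (fun t => F t (y t + h)) volume a b := fun h hh =>
    hF.intervalIntegrable_comp (hy.add continuous_const) (fun t => (hball h hh t).le) a b
  have hGint : ∀ h : E, ‖h‖ < Δ - R → IntervalIntegrable (G h) volume a b := fun h hh =>
    (hgint h).add ((hFy.sub (hFyh h hh)).norm.const_mul _)
  set D : Set E := {h | ∀ᵐ t : ℝ, ((t, y t + h) ∈ S → DifferentiableWithinAt ℝ V S (t, y t + h)) ∧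
    (‖y t + h‖ ≤ Δ → totalDeriv F V t (y t + h) ≤ g (t, y t + h))}
  have hineq : ∀ h ∈ D, ‖h‖ < Δ - R → V (b, y b + h) - V (a, y a + h) ≤ ∫ t in a..b, G h t := by
    intro h hgd hh
    refine sub_le_integral_shift hK hab hFy heq (hSn h hh) (hGint h hh) ?_
    filter_upwards [hgd] with t ht htI
    have hn := hSn h hh t htI
    refine ⟨(ht.1 (mem_of_mem_nhds hn)).differentiableAt hn, ?_⟩
    simp only [hGdef]
    have := ht.2 (hball h hh t).le
    gcongr
  have hDd : Dense D := Measure.dense_of_ae hgood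
  have : (𝓝[D] (0 : E)).NeBot := mem_closure_iff_nhdsWithin_neBot.1 (hDd 0)
  have hsmall : ∀ᶠ h in 𝓝[D] (0 : E), ‖h‖ < Δ - R := by
    refine nhdsWithin_le_nhds ?_
    filter_upwards [Metric.ball_mem_nhds (0 : E) (sub_pos.2 hRΔ)] with h hh using by simpa using hh
  have hyt : ∀ t, Tendsto (fun h : E => (t, y t + h)) (𝓝[D] 0) (𝓝 (t, y t)) := by
    intro t
    have hc : Continuous fun h : E => (t, y t + h) := by fun_prop
    have := (hc.tendsto 0).mono_left (nhdsWithin_le_nhds (s := D))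
    simpa using this
  have hL : Tendsto (fun h => V (b, y b + h) - V (a, y a + h)) (𝓝[D] 0)
      (𝓝 (V (b, y b) - V (a, y a))) :=
    ((hV.continuous.tendsto _).comp (hyt b)).sub ((hV.continuous.tendsto _).comp (hyt a))
  have hR : Tendsto (fun h => ∫ t in a..b, G h t) (𝓝[D] 0) (𝓝 (∫ t in a..b, g (t, y t))) := by
    refine intervalIntegral.tendsto_integral_filter_of_dominated_convergence
      (fun t => M + K * (m t + m t)) ?_ ?_ ?_ ?_
    · filter_upwards [hsmall] with h hh
      exact (hGint h hh).def'.aestronglyMeasurable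
    · filter_upwards [hsmall] with h hh
      filter_upwards [hmb] with t ht htI
      have htI' : t ∈ Icc a b := by
        rw [← uIcc_of_le hab]; exact uIoc_subset_uIcc htI
      refine (norm_add_le _ _).trans (add_le_add (hM _ (mem_of_mem_nhds (hSn h hh t htI'))) ?_)
      rw [norm_mul, norm_norm, Real.norm_of_nonneg K.coe_nonneg]
      refine mul_le_mul_of_nonneg_left ((norm_sub_le _ _).trans ?_) K.coe_nonneg
      exact add_le_add (ht _ ((hyR t).trans hRΔ.le)) (ht _ (hball h hh t).le)
    · have := hm.intervalIntegrable a b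
      exact intervalIntegrable_const.add ((this.add this).const_mul _)
    · filter_upwards [hF.continuous] with t ht _
      have h1 := (hg.tendsto _).comp (hyt t)
      have h2 : Tendsto (fun h : E => F t (y t + h)) (𝓝[D] 0) (𝓝 (F t (y t))) :=
        (ht.tendsto _).comp ((continuous_snd.tendsto _).comp (hyt t))
      have h3 := h1.add (((tendsto_const_nhds (x := F t (y t))).sub h2).norm.const_mul (K : ℝ))
      simpa using h3
  refine le_of_tendsto_of_tendsto hL hR ?_
  filter_upwards [hsmall, self_mem_nhdsWithin] with h hh hhD using hineq h hhD hh

end Chain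

/-! ### Weights for nested families of functions. -/

/-- On a compact set, a large multiple of a nonpositive function pushes another function below any
level that the latter does not reach on the zero set of the former. -/
theorem IsCompact.exists_weight {X : Type*} [TopologicalSpace X] {K : Set X} (hK : IsCompact K)
    {f g : X → ℝ} (hf : Continuous f) (hg : Continuous g) {η : ℝ} (hf0 : ∀ p ∈ K, f p ≤ 0)
    (h : ∀ p ∈ K, f p = 0 → g p < η) : ∃ c : ℝ, 0 ≤ c ∧ ∀ p ∈ K, c * f p + g p < η := by
  have hA : IsCompact (K ∩ {p | η ≤ g p}) := hK.inter_right (isClosed_le continuous_const hg)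
  rcases (K ∩ {p | η ≤ g p}).eq_empty_or_nonempty with he | hne
  · refine ⟨0, le_rfl, fun p hp => ?_⟩
    by_contra! hlt
    have : p ∈ K ∩ {p | η ≤ g p} := ⟨hp, by simpa using hlt⟩
    simp [he] at this
  · obtain ⟨p₀, hp₀, hmax⟩ := hA.exists_isMaxOn hne hf.continuousOn
    obtain ⟨p₁, -, hmax₁⟩ := hK.exists_isMaxOn ⟨p₀, hp₀.1⟩ hg.continuousOn
    have hneg : f p₀ < 0 := lt_of_le_of_ne (hf0 _ hp₀.1) fun h0 =>
      absurd (h _ hp₀.1 h0) (not_lt.2 hp₀.2)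
    have hM : η ≤ g p₁ := le_trans hp₀.2 (hmax₁ hp₀.1)
    -- Where `g ≥ η`, `f` is at most `f p₀ < 0`; this multiple of `f` then brings even the maximum
    -- of `g` down to `η - 1`.
    have hc : 0 ≤ (g p₁ - η + 1) / (-f p₀) := div_nonneg (by linarith) (by linarith)
    refine ⟨_, hc, fun p hp => ?_⟩
    rcases lt_or_ge (g p) η with hlt | hge
    · linarith [mul_nonpos_of_nonneg_of_nonpos hc (hf0 p hp)]
    · have h1 : f p ≤ f p₀ := hmax ⟨hp, hge⟩
      have h2 : g p ≤ g p₁ := hmax₁ hp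
      have h3 := mul_le_mul_of_nonneg_left h1 hc
      have h4 : (g p₁ - η + 1) / (-f p₀) * f p₀ = -(g p₁ - η + 1) := by
        have := hneg.ne
        field_simp
      linarith

/-- If each `Y k` is nonpositive where all its predecessors vanish, then some nonnegative
combination of the `Y i` pushes `Z` below any level not reached on the common zero set. -/
theorem IsCompact.exists_nested_weights {X : Type*} [TopologicalSpace X] {j : ℕ} {K : Set X}
    (hK : IsCompact K) {Y : Fin j → X → ℝ} (hY : ∀ i, Continuous (Y i)) {Z : X → ℝ}
    (hZ : Continuous Z) {η : ℝ}
    (hnest : ∀ k, ∀ p ∈ K, (∀ i, i < k → Y i p = 0) → Y k p ≤ 0)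
    (hzero : ∀ p ∈ K, (∀ i, Y i p = 0) → Z p < η) :
    ∃ c : Fin j → ℝ, (∀ i, 0 ≤ c i) ∧ ∀ p ∈ K, ∑ i, c i * Y i p + Z p < η := by
  -- The tail of the family is nested on the compact set `Y 0 = 0`, so its weights are chosen there
  -- first; the weight of `Y 0` then handles the rest of `K`.
  induction j generalizing K with
  | zero => exact ⟨0, fun _ => le_rfl, fun p hp => by simpa using hzero p hp fun i => i.elim0⟩
  | succ j ih =>
    have hK' : IsCompact (K ∩ {p | Y 0 p = 0}) :=
      hK.inter_right (isClosed_eq (hY 0) continuous_const)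
    obtain ⟨c, hc, hc'⟩ := ih hK' (Y := fun i => Y i.succ) (fun i => hY _)
      (fun k p hp h => hnest k.succ p hp.1 fun i hi => by
        induction i using Fin.cases with
        | zero => exact hp.2
        | succ i => exact h i (Fin.succ_lt_succ_iff.1 hi))
      (fun p hp h => hzero p hp.1 fun i => by
        induction i using Fin.cases with
        | zero => exact hp.2
        | succ i => exact h i)
    obtain ⟨c₀, hc₀, h₀⟩ := hK.exists_weight (hY 0)
      (g := fun p => ∑ i, c i * Y (Fin.succ i) p + Z p)
      ((continuous_finsetSum _ fun i _ => continuous_const.mul (hY _)).add hZ)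
      (fun p hp => hnest 0 p hp fun i hi => absurd hi (Fin.not_lt_zero i))
      (fun p hp h => hc' p ⟨hp, h⟩)
    refine ⟨Fin.cons c₀ c, fun i => ?_, fun p hp => ?_⟩
    · induction i using Fin.cases with
      | zero => exact hc₀
      | succ i => exact hc i
    · have := h₀ p hp
      simp only [Fin.sum_univ_succ, Fin.cons_zero, Fin.cons_succ]
      linarith

/-! ### Persistency of excitation along slow curves. -/

/-- Uniform `δ`-persistency of excitation is robust under slow motion of the state, uniformly over
compact sets. -/
theorem UniformlyDeltaPE.exists_le_integral_curve {E G P : Type*} [NormedAddCommGroup E]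
    [NormedAddCommGroup G] [Zero P] {π : E → P} {φ : ℝ → E → G}
    (hPE : UniformlyDeltaPE π φ) (hφ : Continuous fun p : ℝ × E => φ p.1 p.2)
    (hLip : LocallyLipschitzUniformly φ) {C : Set E} (hC : IsCompact C)
    (hCπ : ∀ p ∈ C, π p ≠ 0) :
    ∃ L > 0, ∃ ε > 0, ∀ p ∈ C, ∀ (s : ℝ) (y : ℝ → E), Continuous y →
      (∀ τ ∈ Icc s (s + L), ‖y τ - p‖ ≤ ε) → ε ≤ ∫ τ in s..(s + L), ‖φ τ (y τ)‖ := by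
  have hcont : ∀ y : ℝ → E, Continuous y → Continuous fun τ => ‖φ τ (y τ)‖ := fun y hy =>
    (hφ.comp (continuous_id.prodMk hy)).norm
  refine hC.induction_on (p := fun A => ∃ L > 0, ∃ ε > 0, ∀ p ∈ A, ∀ (s : ℝ) (y : ℝ → E),
    Continuous y → (∀ τ ∈ Icc s (s + L), ‖y τ - p‖ ≤ ε) → ε ≤ ∫ τ in s..(s + L), ‖φ τ (y τ)‖)
    ⟨1, one_pos, 1, one_pos, fun p hp => absurd hp (notMem_empty p)⟩ ?_ ?_ ?_
  · rintro A B hAB ⟨L, hL, ε, hε, H⟩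
    exact ⟨L, hL, ε, hε, fun p hp => H p (hAB hp)⟩
  -- The integrand is nonnegative, so the claim survives a larger `L` and a smaller `ε`; finite
  -- unions take the maximum and the minimum.
  · have hmono : ∀ {L L' ε ε' : ℝ} {p : E} {s : ℝ} {y : ℝ → E}, 0 < L → L ≤ L' → ε' ≤ ε →
        Continuous y → ((∀ τ ∈ Icc s (s + L), ‖y τ - p‖ ≤ ε) →
          ε ≤ ∫ τ in s..(s + L), ‖φ τ (y τ)‖) →
        (∀ τ ∈ Icc s (s + L'), ‖y τ - p‖ ≤ ε') → ε' ≤ ∫ τ in s..(s + L'), ‖φ τ (y τ)‖ := by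
      intro L L' ε ε' p s y hL hLL hεε hy H h
      refine hεε.trans ((H fun τ hτ => ?_).trans ?_)
      · exact (h τ ⟨hτ.1, hτ.2.trans (by linarith)⟩).trans hεε
      · exact intervalIntegral.integral_mono_interval le_rfl (by linarith) (by linarith)
          (Eventually.of_forall fun _ => norm_nonneg _) ((hcont y hy).intervalIntegrable _ _)
    rintro A B ⟨L, hL, ε, hε, H⟩ ⟨L', hL', ε', hε', H'⟩
    refine ⟨max L L', lt_max_of_lt_left hL, min ε ε', lt_min hε hε', ?_⟩
    rintro p (hp | hp) s y hy h
    · exact hmono hL (le_max_left _ _) (min_le_left _ _) hy (H p hp s y hy) h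
    · exact hmono hL' (le_max_right _ _) (min_le_right _ _) hy (H' p hp s y hy) h
  · intro x hx
    obtain ⟨δ, hδ, T, hT, μ, hμ, hex⟩ := hPE.2 x (hCπ x hx)
    obtain ⟨l, U, hU, hl⟩ := hLip x
    obtain ⟨r, hr, hrU⟩ := Metric.mem_nhds_iff.1 hU
    have hd : 0 < 1 + |l| * T := by positivity
    -- Since `r / 2 + r / 3 < r`, the curve stays in the Lipschitz neighbourhood; `ε * (1 + |l| * T)
    -- ≤ μ` leaves at least `ε` after the Lipschitz loss `|l| * ε * T`.
    refine ⟨Metric.ball x (min δ (r / 2)), mem_nhdsWithin_of_mem_nhds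
      (Metric.ball_mem_nhds x (lt_min hδ (half_pos hr))), T, hT, min (r / 3) (μ / (1 + |l| * T)),
      lt_min (by linarith) (div_pos hμ hd), ?_⟩
    intro p hp s y hy h
    set ε := min (r / 3) (μ / (1 + |l| * T))
    have hpx : ‖p - x‖ < min δ (r / 2) := by simpa [dist_eq_norm] using hp
    have hεr : ε ≤ r / 3 := min_le_left _ _
    have hεμ : ε * (1 + |l| * T) ≤ μ := (le_div_iff₀ hd).1 (min_le_right _ _)
    have hpr : ‖p - x‖ < r / 2 := hpx.trans_le (min_le_right _ _)
    have hpU : p ∈ U := hrU (by rw [Metric.mem_ball, dist_eq_norm]; linarith)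
    have h1 := hex s p (hpx.le.trans (min_le_left _ _))
    have hp' : Continuous fun _ : ℝ => p := continuous_const
    have h2 : ∀ τ ∈ Icc s (s + T), ‖φ τ p‖ - |l| * ε ≤ ‖φ τ (y τ)‖ := by
      intro τ hτ
      have hyU : y τ ∈ U := hrU (by
        rw [Metric.mem_ball, dist_eq_norm, ← sub_add_sub_cancel (y τ) p x]
        linarith [norm_add_le (y τ - p) (p - x), h τ hτ])
      have h3 := hl p hpU (y τ) hyU τ
      have h4 : l * ‖p - y τ‖ ≤ |l| * ε := by
        rw [norm_sub_rev]
        exact mul_le_mul (le_abs_self l) (h τ hτ) (norm_nonneg _) (abs_nonneg l)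
      linarith [norm_sub_norm_le (φ τ p) (φ τ (y τ))]
    have h5 := intervalIntegral.integral_mono_on (by linarith : s ≤ s + T)
      (μ := volume) (((hcont _ hp').sub continuous_const).intervalIntegrable s (s + T))
      ((hcont y hy).intervalIntegrable s (s + T)) h2
    simp only [Pi.sub_apply] at h5
    rw [intervalIntegral.integral_sub ((hcont _ hp').intervalIntegrable _ _)
      intervalIntegrable_const, intervalIntegral.integral_const, add_sub_cancel_left,
      smul_eq_mul] at h5
    nlinarith

/-- Lets the stability estimate restart from a later time at which the state is small. -/
theorem IsSolutionOn.restrict_left {E : Type*} [NormedAddCommGroup E] [NormedSpace ℝ E]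
    {F : ℝ → E → E} {t₀ t₁ : ℝ} {x₀ : E} {x : ℝ → E} (h : IsSolutionOn F t₀ t₁ x₀ x) {s : ℝ}
    (hs : s ∈ Icc t₀ t₁) : IsSolutionOn F s t₁ (x s) x := by
  have hsub : ∀ {u v : ℝ}, u ∈ Icc t₀ t₁ → v ∈ Icc t₀ t₁ → uIcc u v ⊆ uIcc t₀ t₁ := by
    intro u v hu hv
    rw [uIcc_of_le (hs.1.trans hs.2)]
    exact (convex_Icc t₀ t₁).ordConnected.uIcc_subset hu hv
  have h0 : t₀ ∈ Icc t₀ t₁ := left_mem_Icc.2 (hs.1.trans hs.2)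
  have h1 : t₁ ∈ Icc t₀ t₁ := right_mem_Icc.2 (hs.1.trans hs.2)
  refine ⟨h.continuousOn.mono (Icc_subset_Icc_left hs.1),
    h.intervalIntegrable.mono_set (hsub hs h1), fun t ht => ?_⟩
  have ht' : t ∈ Icc t₀ t₁ := ⟨hs.1.trans ht.1, ht.2⟩
  rw [h.integral_eq t ht', h.integral_eq s hs, add_assoc,
    intervalIntegral.integral_add_adjacent_intervals
      (h.intervalIntegrable.mono_set (hsub h0 hs)) (h.intervalIntegrable.mono_set (hsub hs ht'))]

/-! ### Small time averages and a good window. -/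

/-- If a nested family of functions bounds the total derivatives of bounded locally Lipschitz
functions, then every `Z` vanishing on the common zero set has arbitrarily small time average along
bounded solutions. -/
theorem exists_integral_le_of_nested {E G : Type*} [NormedAddCommGroup E] [InnerProductSpace ℝ E]
    [FiniteDimensional ℝ E] [MeasurableSpace E] [BorelSpace E] [NormedAddCommGroup G]
    [ProperSpace G] {F : ℝ → E → E} (hF : IsCaratheodory F) {j : ℕ} {V : Fin j → ℝ × E → ℝ}
    {φ : ℝ → E → G} {Y : Fin j → E × G → ℝ} {μ R Δ : ℝ} (hRΔ : R < Δ)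
    (hV : ∀ i, LocallyLipschitz (V i)) (hφ : Continuous fun p : ℝ × E => φ p.1 p.2)
    (hY : ∀ i, Continuous (Y i))
    (hVμ : ∀ᵐ p : ℝ × E, ‖p.2‖ ≤ Δ → (∀ i, |V i p| ≤ μ) ∧ ‖φ p.1 p.2‖ ≤ μ ∧
      ∀ i, totalDeriv F (V i) p.1 p.2 ≤ Y i (p.2, φ p.1 p.2))
    (hnest : ∀ (k : Fin j) (z : E) (ψ : G), ‖z‖ ≤ Δ → ‖ψ‖ ≤ μ →
      (∀ i, i < k → Y i (z, ψ) = 0) → Y k (z, ψ) ≤ 0)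
    {Z : E × G → ℝ} (hZ : Continuous Z)
    (hzero : ∀ (z : E) (ψ : G), ‖z‖ ≤ Δ → ‖ψ‖ ≤ μ → (∀ i, Y i (z, ψ) = 0) → Z (z, ψ) = 0)
    {η : ℝ} (hη : 0 < η) :
    ∃ M : ℝ, ∀ (y : ℝ → E) (a b : ℝ) (x₀ : E), Continuous y → (∀ t, ‖y t‖ ≤ R) → a ≤ b →
      (∀ t ∈ Icc a b, y t = x₀ + ∫ s in a..t, F s (y s)) →
      ∫ t in a..b, Z (y t, φ t (y t)) ≤ η * (b - a) + M := by
  -- Continuity upgrades the almost everywhere bounds to every point of the open cylinder, which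
  -- contains the trajectory.
  have hU : IsOpen {p : ℝ × E | ‖p.2‖ < Δ} := isOpen_lt continuous_snd.norm continuous_const
  have hVb : ∀ i, ∀ p : ℝ × E, ‖p.2‖ < Δ → |V i p| ≤ μ := fun i =>
    (hV i).continuous.abs.le_on_of_ae_le (μ := volume.prod volume) hU <| by
      filter_upwards [hVμ] with p hp h using (hp (le_of_lt h)).1 i
  have hφb : ∀ p : ℝ × E, ‖p.2‖ < Δ → ‖φ p.1 p.2‖ ≤ μ :=
    hφ.norm.le_on_of_ae_le (μ := volume.prod volume) hU <| by
      filter_upwards [hVμ] with p hp h using (hp (le_of_lt h)).2.1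
  obtain ⟨c, hc, hcZ⟩ := ((isCompact_closedBall (0 : E) Δ).prod
    (isCompact_closedBall (0 : G) μ)).exists_nested_weights hY hZ (η := η)
    (fun k p hp h => hnest k p.1 p.2 (by simpa using hp.1) (by simpa using hp.2) h)
    (fun p hp h => by
      rw [hzero p.1 p.2 (by simpa using hp.1) (by simpa using hp.2) h]; exact hη)
  -- Each `V i` can drop by at most `2 * μ`, whatever the length of the interval.
  refine ⟨∑ i, c i * (2 * μ), fun y a b x₀ hy hyR hab heq => ?_⟩
  have hlt : ∀ t, ‖y t‖ < Δ := fun t => (hyR t).trans_lt hRΔ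
  have hcurve : Continuous fun t => (y t, φ t (y t)) :=
    hy.prodMk (hφ.comp (continuous_id.prodMk hy))
  have hYi : ∀ i, -(2 * μ) ≤ ∫ t in a..b, Y i (y t, φ t (y t)) := by
    intro i
    have h1 := sub_le_integral_of_totalDeriv_le hF (hV i)
      (g := fun p => Y i (p.2, φ p.1 p.2)) ((hY i).comp (continuous_snd.prodMk hφ)) hRΔ
      (by filter_upwards [hVμ] with p hp h using (hp h).2.2 i) hy hyR hab heq
    have h2 := abs_le.1 (hVb i (b, y b) (hlt b))
    have h3 := abs_le.1 (hVb i (a, y a) (hlt a))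
    linarith [h2.1, h3.2]
  have hint : ∀ i, IntervalIntegrable (fun t => c i * Y i (y t, φ t (y t))) volume a b :=
    fun i => (continuous_const.mul ((hY i).comp hcurve)).intervalIntegrable a b
  have hZint : IntervalIntegrable (fun t => Z (y t, φ t (y t))) volume a b :=
    (hZ.comp hcurve).intervalIntegrable a b
  have hsum : IntervalIntegrable (fun t => ∑ i, c i * Y i (y t, φ t (y t))) volume a b :=
    (continuous_finsetSum _ fun i _ =>
      continuous_const.mul ((hY i).comp hcurve)).intervalIntegrable a b
  have hmain := intervalIntegral.integral_mono_on hab (hsum.add hZint)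
    (intervalIntegrable_const (c := η)) fun t _ =>
      (hcZ (y t, φ t (y t)) ⟨by simpa using (hlt t).le, by simpa using hφb (t, y t) (hlt t)⟩).le
  rw [intervalIntegral.integral_add hsum hZint, intervalIntegral.integral_finsetSum fun i _ => hint i,
    intervalIntegral.integral_const, smul_eq_mul] at hmain
  have hlow : -∑ i, c i * (2 * μ) ≤ ∑ i, ∫ t in a..b, c i * Y i (y t, φ t (y t)) := by
    rw [← Finset.sum_neg_distrib]
    refine Finset.sum_le_sum fun i _ => ?_
    rw [intervalIntegral.integral_const_mul]
    nlinarith [mul_le_mul_of_nonneg_left (hYi i) (hc i)]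
  linarith [mul_comm η (b - a)]

/-- A continuous function with small integral over `N` consecutive windows has small integral over
one of them. -/
theorem exists_window_integral_le {f : ℝ → ℝ} (hf : Continuous f) {a L κ : ℝ} {N : ℕ} (hN : 0 < N)
    (h : ∫ t in a..(a + N * L), f t ≤ N * κ) :
    ∃ k < N, ∫ t in (a + k * L)..(a + k * L + L), f t ≤ κ := by
  have hsum : ∑ k ∈ Finset.range N, ∫ t in (a + k * L)..(a + k * L + L), f t =
      ∫ t in a..(a + N * L), f t := by
    have := intervalIntegral.sum_integral_adjacent_intervals (f := f) (μ := volume)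
      (a := fun k : ℕ => a + k * L) (n := N) fun k _ => hf.intervalIntegrable _ _
    simp only [Nat.cast_zero, zero_mul, add_zero] at this
    rw [← this]
    refine Finset.sum_congr rfl fun k _ => ?_
    push_cast
    ring_nf
  obtain ⟨k, hk, hle⟩ := Finset.exists_le_of_sum_le (s := Finset.range N)
    (f := fun k : ℕ => ∫ t in (a + k * L)..(a + k * L + L), f t) (g := fun _ => κ)
    ⟨0, Finset.mem_range.2 hN⟩ (by rw [hsum]; simpa using h)
  exact ⟨k, Finset.mem_range.1 hk, hle⟩

/-! ### Block vectors. -/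

namespace BlockVec

variable {a b : ℕ}

theorem norm_sq_eq (x : BlockVec a b) : ‖x‖ ^ 2 = ‖x.fst‖ ^ 2 + ‖x.snd‖ ^ 2 := by
  simp [EuclideanSpace.norm_sq_eq, fst, snd]

theorem norm_snd_le (x : BlockVec a b) : ‖x.snd‖ ≤ ‖x‖ :=
  abs_le_of_sq_le_sq' (by rw [norm_sq_eq x]; nlinarith [sq_nonneg ‖x.fst‖]) (norm_nonneg x) |>.2

theorem norm_le_add (x : BlockVec a b) : ‖x‖ ≤ ‖x.fst‖ + ‖x.snd‖ := by
  refine abs_le_of_sq_le_sq' ?_ (by positivity) |>.2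
  rw [norm_sq_eq x]
  nlinarith [norm_nonneg x.fst, norm_nonneg x.snd]

/-- The first block as a continuous linear map. -/
noncomputable def fstL (a b : ℕ) : BlockVec a b →L[ℝ] EuclideanSpace ℝ (Fin a) :=
  LinearMap.toContinuousLinearMap
    { toFun := fst, map_add' := fun _ _ => rfl, map_smul' := fun _ _ => rfl }

/-- The second block as a continuous linear map. -/
noncomputable def sndL (a b : ℕ) : BlockVec a b →L[ℝ] EuclideanSpace ℝ (Fin b) :=
  LinearMap.toContinuousLinearMap
    { toFun := snd, map_add' := fun _ _ => rfl, map_smul' := fun _ _ => rfl }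

theorem continuous_fst : Continuous (fst : BlockVec a b → _) := (fstL a b).continuous

theorem continuous_snd : Continuous (snd : BlockVec a b → _) := (sndL a b).continuous

theorem snd_sub (x y : BlockVec a b) : (x - y).snd = x.snd - y.snd := rfl

/-- The vector `col[0, x₂]` obtained from `col[x₁, x₂]`. -/
def killFst (x : BlockVec a b) : BlockVec a b :=
  WithLp.toLp 2 (Sum.elim 0 fun i => x (Sum.inr i))

theorem snd_killFst (x : BlockVec a b) : (killFst x).snd = x.snd := rfl

theorem norm_killFst_sub (x y : BlockVec a b) :
    ‖killFst x - killFst y‖ = ‖x.snd - y.snd‖ := by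
  have h : (killFst x - killFst y).fst = 0 := by
    ext i; simp [killFst, fst]
  rw [← sq_eq_sq₀ (norm_nonneg _) (norm_nonneg _), norm_sq_eq, h, snd_sub, snd_killFst,
    snd_killFst]
  simp

theorem norm_killFst (x : BlockVec a b) : ‖killFst x‖ = ‖x.snd‖ := by
  have h0 : killFst (0 : BlockVec a b) = 0 := by
    ext i; rcases i with i | i <;> simp [killFst]
  have h := norm_killFst_sub x 0
  rwa [h0, sub_zero, show (0 : BlockVec a b).snd = 0 from rfl, sub_zero] at h

theorem continuous_killFst : Continuous (killFst : BlockVec a b → BlockVec a b) := by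
  refine Metric.continuous_iff.2 fun x ε hε => ?_
  refine ⟨ε, hε, fun y hy => lt_of_le_of_lt ?_ hy⟩
  rw [dist_eq_norm, dist_eq_norm, norm_killFst_sub, ← snd_sub]
  exact norm_snd_le _

end BlockVec

/-! ### From small integrals to attractivity. -/

/-- A solution on `[t₀, t₁]` extends to a continuous curve on `ℝ` with the same range that satisfies
the same integral equation. -/
theorem IsSolutionOn.exists_continuous_extension {E : Type*} [NormedAddCommGroup E]
    [NormedSpace ℝ E] {F : ℝ → E → E} {t₀ t₁ : ℝ} {x₀ : E} {x : ℝ → E}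
    (h : IsSolutionOn F t₀ t₁ x₀ x) (h01 : t₀ ≤ t₁) :
    ∃ y : ℝ → E, Continuous y ∧ EqOn y x (Icc t₀ t₁) ∧ (∀ t, ∃ s ∈ Icc t₀ t₁, y t = x s) ∧
      ∀ t ∈ Icc t₀ t₁, y t = x₀ + ∫ s in t₀..t, F s (y s) := by
  have hE : EqOn (IccExtend h01 ((Icc t₀ t₁).domRestrict x)) x (Icc t₀ t₁) := fun t ht => by
    rw [IccExtend_of_mem h01 _ ht, domRestrict_apply]
  refine ⟨IccExtend h01 ((Icc t₀ t₁).domRestrict x), h.continuousOn.domRestrict.Icc_extend',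
    hE, fun t => ⟨_, (projIcc t₀ t₁ h01 t).2, rfl⟩, fun t ht => ?_⟩
  rw [hE ht, h.integral_eq t ht]
  congr 1
  refine intervalIntegral.integral_congr fun s hs => ?_
  rw [uIcc_of_le ht.1] at hs
  simp only [hE ⟨hs.1, hs.2.trans ht.2⟩]

/-- If the excitation `φ₁`, the first block, and the bound `w` on the velocity of the second block
have small integral over a window long enough for the excitation of `φ₁` to show, then the state is
small at some time of the window. -/
theorem exists_norm_le_of_window {a b : ℕ} {G : Type*} [NormedAddCommGroup G]
    {φ₁ : ℝ → BlockVec a b → G} (hφ : Continuous fun p : ℝ × BlockVec a b => φ₁ p.1 p.2)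
    (hind : ∀ t x y, x.snd = y.snd → φ₁ t x = φ₁ t y) {L ε δ R κ s : ℝ} (hL : 0 < L)
    (hPE : ∀ p ∈ {p : BlockVec a b | ‖p‖ ≤ R ∧ δ / 2 ≤ ‖p.snd‖}, ∀ (s : ℝ)
      (y : ℝ → BlockVec a b), Continuous y → (∀ τ ∈ Icc s (s + L), ‖y τ - p‖ ≤ ε) →
      ε ≤ ∫ τ in s..(s + L), ‖φ₁ τ (y τ)‖)
    {y : ℝ → BlockVec a b} (hy : Continuous y) (hyR : ∀ t, ‖y t‖ ≤ R)
    {w : ℝ → ℝ} (hw : Continuous w) (hw0 : ∀ t, 0 ≤ w t)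
    (hinc : ∀ u ∈ Icc s (s + L), ∀ v ∈ Icc s (s + L), u ≤ v →
      ‖(y v).snd - (y u).snd‖ ≤ ∫ t in u..v, w t)
    (hκε : κ < ε) (hκL : κ ≤ L * (δ / 2))
    (hint : ∫ t in s..(s + L), (‖(y t).fst‖ + ‖φ₁ t (y t)‖ + w t) ≤ κ) :
    ∃ τ ∈ Icc s (s + L), ‖y τ‖ ≤ δ := by
  by_contra! hbig
  have hsL : s ≤ s + L := by linarith
  have c1 : Continuous fun t => ‖(y t).fst‖ := (BlockVec.continuous_fst.comp hy).norm
  have c2 : Continuous fun t => ‖φ₁ t (y t)‖ := (hφ.comp (continuous_id.prodMk hy)).norm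
  have i1 := c1.intervalIntegrable (μ := volume) s (s + L)
  have i2 := c2.intervalIntegrable (μ := volume) s (s + L)
  have iw := hw.intervalIntegrable (μ := volume) s (s + L)
  rw [intervalIntegral.integral_add (i1.add i2) iw, intervalIntegral.integral_add i1 i2] at hint
  have n1 : 0 ≤ ∫ t in s..(s + L), ‖(y t).fst‖ :=
    intervalIntegral.integral_nonneg hsL fun _ _ => norm_nonneg _
  have n2 : 0 ≤ ∫ t in s..(s + L), ‖φ₁ t (y t)‖ :=
    intervalIntegral.integral_nonneg hsL fun _ _ => norm_nonneg _
  have nw : 0 ≤ ∫ t in s..(s + L), w t :=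
    intervalIntegral.integral_nonneg hsL fun _ _ => hw0 _
  -- Otherwise the first block alone would contribute more than `L * (δ / 2) ≥ κ`.
  obtain ⟨u, hu, hu1⟩ : ∃ u ∈ Icc s (s + L), ‖(y u).fst‖ ≤ δ / 2 := by
    by_contra! h
    have hlt := intervalIntegral.integral_lt_integral_of_continuousOn_of_le_of_exists_lt
      (by linarith : s < s + L) (continuousOn_const (c := δ / 2)) c1.continuousOn
      (fun t ht => (h t (Ioc_subset_Icc_self ht)).le) ⟨s, left_mem_Icc.2 hsL, h s (left_mem_Icc.2 hsL)⟩
    rw [intervalIntegral.integral_const, add_sub_cancel_left, smul_eq_mul] at hlt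
    linarith
  have hu2 : δ / 2 ≤ ‖(y u).snd‖ := by
    linarith [hbig u hu, BlockVec.norm_le_add (y u)]
  have hinc' : ∀ τ ∈ Icc s (s + L), ‖(y τ).snd - (y u).snd‖ ≤ κ := by
    have hsub : ∀ p ∈ Icc s (s + L), ∀ q ∈ Icc s (s + L), p ≤ q →
        ‖(y q).snd - (y p).snd‖ ≤ κ := fun p hp q hq hpq => by
      have := intervalIntegral.integral_mono_interval hp.1 hpq hq.2
        (Eventually.of_forall fun t => hw0 t) iw
      linarith [hinc p hp q hq hpq]
    intro τ hτ
    rcases le_total u τ with h | h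
    · exact hsub u hu τ hτ h
    · rw [norm_sub_rev]; exact hsub τ hτ u hu h
  -- Excitation is tested on `col[0, x₂]`: this leaves `φ₁` unchanged and removes the motion of
  -- `x₁`, which is not controlled.
  have hfinal := hPE (y u).killFst
    ⟨by rw [BlockVec.norm_killFst]; exact (BlockVec.norm_snd_le _).trans (hyR u),
      by rwa [BlockVec.snd_killFst]⟩ s (fun t => (y t).killFst)
    (BlockVec.continuous_killFst.comp hy)
    (fun τ hτ => by rw [BlockVec.norm_killFst_sub]; exact (hinc' τ hτ).trans hκε.le)
  rw [intervalIntegral.integral_congr (g := fun t => ‖φ₁ t (y t)‖) fun t _ => by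
    simp only [hind t (y t).killFst (y t) (BlockVec.snd_killFst _)]] at hfinal
  linarith

theorem mainTheorem2 {n₁ n₂ j m₁ m₂ : ℕ} (hj : 0 < j) (hm₁ : 0 < m₁)
    (F : ℝ → BlockVec n₁ n₂ → BlockVec n₁ n₂) (hF : IsCaratheodory F)
    (hUGS : UGS F)
    (hAux : ∀ Δ : ℝ, 0 < Δ →
      ∃ (μ : ℝ) (V : Fin j → ℝ × BlockVec n₁ n₂ → ℝ)
        (φ : ℝ → BlockVec n₁ n₂ → BlockVec m₁ m₂)
        (Y : Fin j → BlockVec n₁ n₂ × BlockVec m₁ m₂ → ℝ)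
        (ρ : EuclideanSpace ℝ (Fin n₁) × EuclideanSpace ℝ (Fin m₁) → ℝ),
        0 < μ ∧
        (∀ i, LocallyLipschitz (V i)) ∧
        Continuous (fun p : ℝ × BlockVec n₁ n₂ => φ p.1 p.2) ∧
        (∀ i, Continuous (Y i)) ∧
        -- bounds on the auxiliary functions and on their derivatives along the system
        (∀ᵐ p : ℝ × BlockVec n₁ n₂, ‖p.2‖ ≤ Δ →
          (∀ i, |V i p| ≤ μ) ∧ ‖φ p.1 p.2‖ ≤ μ ∧
          ∀ i, totalDeriv F (V i) p.1 p.2 ≤ Y i (p.2, φ p.1 p.2)) ∧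
        -- nested condition
        (∀ (k : Fin j) (z : BlockVec n₁ n₂) (ψ : BlockVec m₁ m₂), ‖z‖ ≤ Δ → ‖ψ‖ ≤ μ →
          (∀ i, i < k → Y i (z, ψ) = 0) → Y k (z, ψ) ≤ 0) ∧
        -- all bounds vanishing forces the first blocks to vanish
        (∀ (z : BlockVec n₁ n₂) (ψ : BlockVec m₁ m₂), ‖z‖ ≤ Δ → ‖ψ‖ ≤ μ →
          (∀ i, Y i (z, ψ) = 0) → z.fst = 0 ∧ ψ.fst = 0) ∧
        -- the first block of `φ`: independent of `x₁`, locally Lipschitz, exciting, zero at zero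
        (∀ (t : ℝ) (x y : BlockVec n₁ n₂), x.snd = y.snd → (φ t x).fst = (φ t y).fst) ∧
        LocallyLipschitzUniformly (fun t x => (φ t x).fst) ∧
        UniformlyDeltaPE BlockVec.snd (fun t x => (φ t x).fst) ∧
        (∀ t : ℝ, (φ t 0).fst = 0) ∧
        -- bound on the second block of the vector field
        Continuous ρ ∧ ρ (0, 0) = 0 ∧
        (∀ (t : ℝ) (x : BlockVec n₁ n₂), ‖x‖ ≤ Δ →
          ‖(F t x).snd‖ ≤ ρ (x.fst, (φ t x).fst))) :
    UGAS F := by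
  refine ⟨hUGS, fun r hr σ hσ => ?_⟩
  obtain ⟨γ, hγ, hsol⟩ := hUGS
  have hγmono := hγ.strictMonoOn.monotoneOn
  obtain ⟨δ, hδ, hγδ⟩ : ∃ δ > 0, γ δ ≤ σ := by
    have hc : Tendsto γ (𝓝[>] 0) (𝓝 0) := by
      have := (hγ.continuousOn 0 self_mem_Ici).tendsto
      rw [hγ.map_zero] at this
      exact this.mono_left (nhdsWithin_mono _ Ioi_subset_Ici_self)
    obtain ⟨δ, h1, h2⟩ := ((hc.eventually_le_const hσ).and self_mem_nhdsWithin).exists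
    exact ⟨δ, h2, h1⟩
  have hR : 0 < γ r := by
    simpa [hγ.map_zero] using hγ.strictMonoOn self_mem_Ici hr.le hr
  set R := γ r
  obtain ⟨μ, V, φ, Y, ρ, -, hV, hφ, hY, hVμ, hnest, hzero, hind, hLip, hPE, -, hρ, hρ0, hF₂⟩ :=
    hAux (R + 1) (by linarith)
  have hφ₁ : Continuous fun p : ℝ × BlockVec n₁ n₂ => (φ p.1 p.2).fst :=
    BlockVec.continuous_fst.comp hφ
  have hC : IsCompact {p : BlockVec n₁ n₂ | ‖p‖ ≤ R ∧ δ / 2 ≤ ‖p.snd‖} := by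
    refine (isCompact_closedBall (0 : BlockVec n₁ n₂) R).of_isClosed_subset
      ((isClosed_le continuous_norm continuous_const).inter
        (isClosed_le continuous_const BlockVec.continuous_snd.norm)) fun p hp => ?_
    simpa using hp.1
  obtain ⟨L, hL, ε, hε, hexc⟩ := hPE.exists_le_integral_curve hφ₁ hLip hC fun p hp h0 => by
    have := hp.2
    rw [h0, norm_zero] at this
    linarith
  set Z : BlockVec n₁ n₂ × BlockVec m₁ m₂ → ℝ := fun p =>
    ‖p.1.fst‖ + ‖p.2.fst‖ + |ρ (p.1.fst, p.2.fst)| with hZdef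
  have hρc : Continuous fun p : BlockVec n₁ n₂ × BlockVec m₁ m₂ => |ρ (p.1.fst, p.2.fst)| :=
    (hρ.comp ((BlockVec.continuous_fst.comp continuous_fst).prodMk
      (BlockVec.continuous_fst.comp continuous_snd))).abs
  have hZ : Continuous Z :=
    ((BlockVec.continuous_fst.comp continuous_fst).norm.add
      (BlockVec.continuous_fst.comp continuous_snd).norm).add hρc
  -- The budget for `∫ Z` per window. With `η = κ / (2 * L)` the average uses half of it; `N` is
  -- taken so large that the other halves absorb `M`.
  set κ := min (ε / 2) (L * (δ / 2))
  have hκ : 0 < κ := lt_min (by linarith) (by positivity)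
  obtain ⟨M, hM⟩ := exists_integral_le_of_nested hF (lt_add_one R) hV hφ hY hVμ hnest hZ
    (fun z ψ hz hψ h => by
      obtain ⟨h1, h2⟩ := hzero z ψ hz hψ h
      simp [hZdef, h1, h2, hρ0]) (η := κ / (2 * L)) (by positivity)
  obtain ⟨N, hN⟩ := exists_nat_gt (max 0 (2 * M / κ))
  have hN0 : (0 : ℝ) < N := (le_max_left _ _).trans_lt hN
  have hNM : M ≤ N * (κ / 2) := by
    have := (div_lt_iff₀ hκ).1 ((le_max_right _ _).trans_lt hN)
    linarith
  refine ⟨N * L, by positivity, fun t₀ t₁ x₀ x hx hx₀ t ht => ?_⟩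
  have h01 : t₀ ≤ t₁ := by linarith [ht.1, ht.2, mul_pos hN0 hL]
  obtain ⟨y, hy, hyx, hyr, hyeq⟩ := hx.exists_continuous_extension h01
  have hyR : ∀ s, ‖y s‖ ≤ R := fun s => by
    obtain ⟨s', hs', e⟩ := hyr s
    rw [e]
    exact (hsol _ _ _ _ hx s' hs').trans (hγmono (norm_nonneg _) hr.le hx₀)
  have hcurve : Continuous fun s => (y s, φ s (y s)) :=
    hy.prodMk (hφ.comp (continuous_id.prodMk hy))
  have hTt : t₀ + N * L ≤ t₁ := ht.1.trans ht.2
  have hbound : ∫ s in t₀..(t₀ + N * L), Z (y s, φ s (y s)) ≤ N * κ := by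
    have h := hM y t₀ (t₀ + N * L) x₀ hy hyR (by linarith [mul_pos hN0 hL])
      fun s hs => hyeq s ⟨hs.1, hs.2.trans hTt⟩
    have e : κ / (2 * L) * (t₀ + N * L - t₀) = N * (κ / 2) := by
      field_simp
      ring
    rw [e] at h
    linarith
  obtain ⟨k, hkN, hk⟩ := exists_window_integral_le (hZ.comp hcurve) (by exact_mod_cast hN0) hbound
  set s := t₀ + k * L
  have hs0 : t₀ ≤ s := le_add_of_nonneg_right (by positivity)
  have hsN : s + L ≤ t₀ + N * L := by
    have h1 : (k : ℝ) + 1 ≤ N := by exact_mod_cast hkN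
    have := mul_le_mul_of_nonneg_right h1 hL.le
    simp only [s]
    linarith
  have hwin : Icc s (s + L) ⊆ Icc t₀ t₁ := Icc_subset_Icc hs0 (hsN.trans hTt)
  have hFint := hF.intervalIntegrable_comp hy hyR
  obtain ⟨τ, hτ, hτδ⟩ := exists_norm_le_of_window hφ₁ hind hL hexc hy hyR
    (w := fun s => |ρ ((y s).fst, (φ s (y s)).fst)|) (hρc.comp hcurve) (fun _ => abs_nonneg _)
    (fun u hu v hv huv => by
      have e : y v - y u = ∫ q in u..v, F q (y q) := by
        rw [hyeq v (hwin hv), hyeq u (hwin hu), add_sub_add_left_eq_sub]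
        exact intervalIntegral.integral_interval_sub_left (hFint _ _) (hFint _ _)
      have e2 : (y v).snd - (y u).snd = ∫ q in u..v, (F q (y q)).snd := by
        rw [← BlockVec.snd_sub, e]
        exact ((BlockVec.sndL n₁ n₂).intervalIntegral_comp_comm (hFint u v)).symm
      rw [e2]
      exact intervalIntegral.norm_integral_le_of_norm_le huv
        (Eventually.of_forall fun q _ => (hF₂ q (y q) (by linarith [hyR q])).trans (le_abs_self _))
        ((hρc.comp hcurve).intervalIntegrable u v))
    (lt_of_le_of_lt (min_le_left _ _) (by linarith : ε / 2 < ε)) (min_le_right _ _) hk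
  rw [hyx (hwin hτ)] at hτδ
  have hτt : t ∈ Icc τ t₁ := ⟨hτ.2.trans (hsN.trans ht.1), ht.2⟩
  exact (hsol _ _ _ _ (hx.restrict_left (hwin hτ)) t hτt).trans
    ((hγmono (norm_nonneg _) hδ.le hτδ).trans hγδ)
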